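/- Let $X$ be a real Banach space with dual $X^*$, write $\langle x,w\rangle=w(x)$, let $y_1,\dots,y_m\in\{-1,1\}$, and suppose that $I_+=\{i:y_i=1\}$ and $I_-=\{i:y_i=-1\}$ are both nonempty. Let $K_1,\dots,K_m\subset X$ be nonempty, convex and weakly compact, put $K=\prod_{i=1}^m K_i$ and $K_\pm=\mathrm{co}\big(\bigcup_{i\in I_\pm}K_i\big)$, and assume $K_+\cap K_-=\emptyset$. Consider the optimization problems (R-SVM) minimize $\frac12\|w\|^2$ over $(w,b)\in X^*\times\mathbb R$ subject to $\min_{x_i\in K_i}y_i(\langle x_i,w\rangle+b)\ge 1$, $i=1,\dots,m$; (OD-SVM) maximize $\sum_{i=1}^m\lambda_i-\frac12\big\|\sum_{i=1}^m\lambda_iy_ix_i\big\|^2$ over $(\lambda,x)\in\mathbb R_+^m\times K$ subject to $\sum_{i=1}^m\lambda_iy_i=0$; (R-CM) minimize $\frac12\|w\|^2-(\alpha-\beta)$ over $(w,\alpha,\beta)\in X^*\times\mathbb R\times\mathbb R$ subject to $\min_{x_i\in K_i}\langle x_i,w\rangle\ge\alpha$ for $i\in I_+$ and $\max_{x_i\in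 K_i}\langle x_i,w\rangle\le\beta$ for $i\in I_-$; (OD-CM) maximize $-\frac12\big\|\sum_{i=1}^m\lambda_iy_ix_i\big\|^2$ over $(\lambda,x)\in\mathbb R_+^m\times K$ subject to $\sum_{i\in I_+}\lambda_i=1$ and $\sum_{i\in I_-}\lambda_i=1$. A solution of a pair of problems consists of a solution of the first together with a solution of the second. 1. If $(\bar w,\bar b;\bar\lambda,\bar x)$ is a solution of the pair (R-SVM)–(OD-SVM), then $S:=\sum_{i=1}^m\bar\lambda_i\neq0$ and $$\left(\frac{2\bar w}{S},\ \frac{2(1-\bar b)}{S},\ \frac{2(-1-\bar b)}{S};\ \frac{2\bar\lambda}{S},\ \bar x\right)$$ is a solution of the pair (R-CM)–(OD-CM). 2. If $(\bar w,\bar\alpha,\bar\beta;\bar\lambda,\bar x)$ is a solution of the pair (R-CM)–(OD-CM), then $\bar\alpha-\bar\beta\ne0$ and $$\left(\frac{2\bar w}{\bar\alpha-\bar\beta},\ -\frac{\bar\alpha+\bar\beta}{\bar\alpha-\bar\beta};\ \frac{2\bar\lambda}{\bar\alpha-\bar\beta},\ \bar x\right)$$ is a solution of the pair (R-SVM)–(OD-SVM).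 3. (OD-CM) is the problem of the nearest points between $K_+$ and $K_-$. For $(\lambda,x)$ put $p_\pm(\lambda,x)=\sum_{i\in I_\pm}\lambda_ix_i$ and let $\mathrm{dist}(K_+,K_-)=\inf\{\|p-q\|:p\in K_+,\ q\in K_-\}$. As $(\lambda,x)$ runs over the feasible points of (OD-CM), $(p_+(\lambda,x),p_-(\lambda,x))$ runs over exactly $K_+\times K_-$; the objective at $(\lambda,x)$ is $-\frac12\|p_+(\lambda,x)-p_-(\lambda,x)\|^2$; a feasible $(\lambda,x)$ is a solution if and only if $\|p_+(\lambda,x)-p_-(\lambda,x)\|=\mathrm{dist}(K_+,K_-)$; and the optimal value is $-\frac12\,\mathrm{dist}(K_+,K_-)^2$. -/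

import Mathlib

noncomputable section

namespace RobustSVM

/-- `a` is a solution of the problem of minimizing `f` over the feasible set `S`. -/
def SolvesMin {A : Type*} (f : A → ℝ) (S : Set A) (a : A) : Prop :=
  a ∈ S ∧ ∀ a' ∈ S, f a ≤ f a'

/-- `a` is a solution of the problem of maximizing `f` over the feasible set `S`. -/
def SolvesMax {A : Type*} (f : A → ℝ) (S : Set A) (a : A) : Prop :=
  a ∈ S ∧ ∀ a' ∈ S, f a' ≤ f a

variable {X : Type*} [NormedAddCommGroup X] [NormedSpace ℝ X] {m : ℕ}

/-- The set `s` is compact for the weak topology `σ(X, X*)`. -/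
def WeaklyCompact (s : Set X) : Prop :=
  IsCompact (toWeakSpace ℝ X '' s)

/-- The indices of the class labelled `c` (used with `c = 1` and `c = -1`). -/
def classIdx (y : Fin m → ℝ) (c : ℝ) : Finset (Fin m) :=
  Finset.univ.filter fun i => y i = c

/-- The convex hull of the uncertainty sets of the class labelled `c`:
`c = 1` gives `K₊`, `c = -1` gives `K₋`. -/
def classHull (K : Fin m → Set X) (y : Fin m → ℝ) (c : ℝ) : Set X :=
  convexHull ℝ (⋃ i ∈ classIdx y c, K i)

/-- `dist(A, B) = inf {‖p - q‖ : p ∈ A, q ∈ B}`. -/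
def setDist (A B : Set X) : ℝ :=
  sInf {r : ℝ | ∃ p ∈ A, ∃ q ∈ B, r = ‖p - q‖}

/-- `p` and `q` are nearest points between `A` and `B`. -/
def NearestPair (A B : Set X) (p q : X) : Prop :=
  p ∈ A ∧ q ∈ B ∧ ‖p - q‖ = setDist A B

/-- Feasible `(w, b)` for (R-SVM): `min_{x ∈ K i} y i (⟨x, w⟩ + b) ≥ 1` for every `i`. -/
def feasRSVM (K : Fin m → Set X) (y : Fin m → ℝ) : Set (StrongDual ℝ X × ℝ) :=
  {v | ∀ i, ∀ x ∈ K i, 1 ≤ y i * (v.1 x + v.2)}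

def objRSVM (v : StrongDual ℝ X × ℝ) : ℝ :=
  (1 / 2) * ‖v.1‖ ^ 2

/-- `(w, b)` is a solution of (R-SVM). -/
def SolvesRSVM (K : Fin m → Set X) (y : Fin m → ℝ) (w : StrongDual ℝ X) (b : ℝ) : Prop :=
  SolvesMin objRSVM (feasRSVM K y) (w, b)

/-- Feasible `(w, α, β)` for (R-CM): `min_{x ∈ K i} ⟨x, w⟩ ≥ α` on the positive class and
`max_{x ∈ K i} ⟨x, w⟩ ≤ β` on the negative class. -/
def feasRCM (K : Fin m → Set X) (y : Fin m → ℝ) : Set (StrongDual ℝ X × ℝ × ℝ) :=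
  {v | (∀ i ∈ classIdx y 1, ∀ x ∈ K i, v.2.1 ≤ v.1 x) ∧
       (∀ i ∈ classIdx y (-1), ∀ x ∈ K i, v.1 x ≤ v.2.2)}

def objRCM (v : StrongDual ℝ X × ℝ × ℝ) : ℝ :=
  (1 / 2) * ‖v.1‖ ^ 2 - (v.2.1 - v.2.2)

/-- `(w, α, β)` is a solution of (R-CM). -/
def SolvesRCM (K : Fin m → Set X) (y : Fin m → ℝ) (w : StrongDual ℝ X) (α β : ℝ) : Prop :=
  SolvesMin objRCM (feasRCM K y) (w, α, β)

/-- Feasible `(l, x)` for (OD-SVM): `l ∈ ℝ₊ᵐ`, `x ∈ ∏ K i` and `∑ l i * y i = 0`. -/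
def feasODSVM (K : Fin m → Set X) (y : Fin m → ℝ) : Set ((Fin m → ℝ) × (Fin m → X)) :=
  {v | (∀ i, 0 ≤ v.1 i) ∧ (∀ i, v.2 i ∈ K i) ∧ ∑ i, v.1 i * y i = 0}

def objODSVM (y : Fin m → ℝ) (v : (Fin m → ℝ) × (Fin m → X)) : ℝ :=
  (∑ i, v.1 i) - (1 / 2) * ‖∑ i, (v.1 i * y i) • v.2 i‖ ^ 2

/-- `(l, x)` is a solution of (OD-SVM). -/
def SolvesODSVM (K : Fin m → Set X) (y : Fin m → ℝ) (l : Fin m → ℝ) (x : Fin m → X) : Prop :=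
  SolvesMax (objODSVM y) (feasODSVM K y) (l, x)

/-- Feasible `(l, x)` for (OD-CM): `l ∈ ℝ₊ᵐ`, `x ∈ ∏ K i`, and `l` sums to `1` over each class. -/
def feasODCM (K : Fin m → Set X) (y : Fin m → ℝ) : Set ((Fin m → ℝ) × (Fin m → X)) :=
  {v | (∀ i, 0 ≤ v.1 i) ∧ (∀ i, v.2 i ∈ K i) ∧
       ∑ i ∈ classIdx y 1, v.1 i = 1 ∧ ∑ i ∈ classIdx y (-1), v.1 i = 1}

def objODCM (y : Fin m → ℝ) (v : (Fin m → ℝ) × (Fin m → X)) : ℝ :=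
  -((1 / 2) * ‖∑ i, (v.1 i * y i) • v.2 i‖ ^ 2)

/-- `(l, x)` is a solution of (OD-CM). -/
def SolvesODCM (K : Fin m → Set X) (y : Fin m → ℝ) (l : Fin m → ℝ) (x : Fin m → X) : Prop :=
  SolvesMax (objODCM y) (feasODCM K y) (l, x)

/-- The point `∑ l i • x i`, the sum running over the class labelled `c`. -/
def classPoint (y : Fin m → ℝ) (c : ℝ) (l : Fin m → ℝ) (x : Fin m → X) : X :=
  ∑ i ∈ classIdx y c, l i • x i

end RobustSVM

end

open RobustSVM

open RobustSVM

namespace RobustSVM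

/-! ### Distance between two sets and separation by a functional. -/

section Sets

open scoped Pointwise

variable {X : Type*} [NormedAddCommGroup X] {A B : Set X}

/-! Everything is governed by one number, `d = dist(K₊, K₋)`. When `d > 0`, a feasible point solves
(R-CM) iff `‖w‖ = d` and `α - β = d²`; (R-SVM) iff `‖w‖ = 2/d`; (OD-SVM) iff `∑ l i = 4/d²` and `‖∑
l i y i x i‖ = 2/d`. It solves (OD-CM) iff `‖∑ l i y i x i‖ = d`. The constraints are compatible
with rescaling, so both correspondences reduce to matching these numbers: `2/S = d²/2` in one
direction, `2/(α - β) = 2/d²` in the other.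

On the primal side the bound is `α - β ≤ ‖w‖ d` (`sub_le_norm_mul_setDist`), sharp by Hahn–Banach
(`exists_separating_norm_eq_setDist`). On the dual side the feasible points of (OD-CM) parametrize
`K₊ × K₋` (`mem_classHull_iff_exists_feasODCM`). Positivity of `d` is read off the given solution.
-/

theorem bddBelow_dist_set (A B : Set X) :
    BddBelow {r : ℝ | ∃ p ∈ A, ∃ q ∈ B, r = ‖p - q‖} :=
  ⟨0, by rintro r ⟨p, -, q, -, rfl⟩; exact norm_nonneg _⟩

theorem setDist_le {p q : X} (hp : p ∈ A) (hq : q ∈ B) : setDist A B ≤ ‖p - q‖ :=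
  csInf_le (bddBelow_dist_set A B) ⟨p, hp, q, hq, rfl⟩

theorem le_setDist (hA : A.Nonempty) (hB : B.Nonempty) {c : ℝ}
    (h : ∀ p ∈ A, ∀ q ∈ B, c ≤ ‖p - q‖) : c ≤ setDist A B := by
  obtain ⟨p, hp⟩ := hA
  obtain ⟨q, hq⟩ := hB
  refine le_csInf ⟨_, p, hp, q, hq, rfl⟩ ?_
  rintro r ⟨p, hp, q, hq, rfl⟩
  exact h p hp q hq

theorem setDist_nonneg (A B : Set X) : 0 ≤ setDist A B :=
  Real.sInf_nonneg (by rintro r ⟨p, -, q, -, rfl⟩; exact norm_nonneg _)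

theorem le_setDist_sq (hA : A.Nonempty) (hB : B.Nonempty) {c : ℝ}
    (h : ∀ p ∈ A, ∀ q ∈ B, c ≤ ‖p - q‖ ^ 2) : c ≤ setDist A B ^ 2 :=
  -- A negative `c` is covered as well, since its square root is `0`.
  (Real.sqrt_le_left (setDist_nonneg A B)).1 <| le_setDist hA hB fun p hp q hq =>
    (Real.sqrt_le_left (norm_nonneg _)).2 (h p hp q hq)

variable [NormedSpace ℝ X]

theorem sub_le_norm_mul_setDist (hA : A.Nonempty) (hB : B.Nonempty) {w : StrongDual ℝ X} {a b : ℝ}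
    (ha : ∀ p ∈ A, a ≤ w p) (hb : ∀ q ∈ B, w q ≤ b) : a - b ≤ ‖w‖ * setDist A B := by
  have key : ∀ p ∈ A, ∀ q ∈ B, a - b ≤ ‖w‖ * ‖p - q‖ := fun p hp q hq =>
    calc a - b ≤ w (p - q) := by rw [map_sub]; linarith [ha p hp, hb q hq]
      _ ≤ ‖w (p - q)‖ := le_abs_self _
      _ ≤ ‖w‖ * ‖p - q‖ := w.le_opNorm _
  -- Passing to the infimum requires dividing by `‖w‖`; if `w = 0`, any single pair suffices.
  rcases (norm_nonneg w).eq_or_lt with h0 | h0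
  · obtain ⟨p, hp⟩ := hA
    obtain ⟨q, hq⟩ := hB
    simpa [← h0] using key p hp q hq
  · rw [← div_le_iff₀' h0]
    exact le_setDist hA hB fun p hp q hq => (div_le_iff₀' h0).2 (key p hp q hq)

/-- Two convex sets at positive distance `d` are separated by a functional of norm `d` with
gap `d ^ 2`. -/
theorem exists_separating_norm_eq_setDist (hA : A.Nonempty) (hB : B.Nonempty)
    (cA : Convex ℝ A) (cB : Convex ℝ B) (hd : 0 < setDist A B) :
    ∃ (w : StrongDual ℝ X) (a b : ℝ), (∀ p ∈ A, a ≤ w p) ∧ (∀ q ∈ B, w q ≤ b) ∧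
      ‖w‖ = setDist A B ∧ a - b = setDist A B ^ 2 := by
  obtain ⟨p₀, hp₀⟩ := hA
  obtain ⟨q₀, hq₀⟩ := hB
  set d := setDist A B with hd_def
  -- All of `A - B` has norm at least `d`, so the open ball of radius `d` can be separated from it.
  have hdis : Disjoint (Metric.ball (0 : X) d) (A - B) := by
    rw [Set.disjoint_left]
    rintro z hz ⟨p, hp, q, hq, rfl⟩
    exact (mem_ball_zero_iff.1 hz).not_ge (setDist_le hp hq)
  obtain ⟨f, u, hfu, huf⟩ :=
    geometric_hahn_banach_open (convex_ball 0 d) Metric.isOpen_ball (cA.sub cB) hdis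
  have hu : 0 < u := by simpa using hfu 0 (Metric.mem_ball_self hd)
  -- The supremum of `f` over the ball is `‖f‖ d`, so `f` is at least `‖f‖ d` on `A - B`.
  have hf : ‖f‖ * d ≤ u := by
    rw [← le_div_iff₀ hd]
    have hcl : ∀ z ∈ Metric.closedBall (0 : X) d, f z ≤ u := by
      rw [← closure_ball 0 hd.ne']
      exact closure_minimal (fun z hz => (hfu z hz).le) (isClosed_le f.continuous continuous_const)
    refine ContinuousLinearMap.opNorm_le_of_unit_norm (by positivity) fun z hz => ?_
    have h1 := hcl (d • z) (by simp [norm_smul, hz, abs_of_pos hd])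
    have h2 := hcl (-(d • z)) (by simp [norm_smul, hz, abs_of_pos hd])
    simp only [map_neg, map_smul, smul_eq_mul] at h1 h2
    rw [Real.norm_eq_abs, le_div_iff₀ hd, ← abs_of_pos hd, ← abs_mul]
    exact abs_le.2 ⟨by linarith, by linarith⟩
  have hf0 : 0 < ‖f‖ := by
    rw [norm_pos_iff]
    rintro rfl
    have := huf _ (Set.sub_mem_sub hp₀ hq₀)
    simp at this
    linarith
  -- Normalizing to norm `d` turns the gap `‖f‖ d` into `d²`.
  set w := (d / ‖f‖) • f with hw
  have hgap : ∀ p ∈ A, ∀ q ∈ B, w q + d ^ 2 ≤ w p := by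
    intro p hp q hq
    have h1 : ‖f‖ * d ≤ f p - f q := by
      rw [← map_sub]; exact hf.trans (huf _ (Set.sub_mem_sub hp hq))
    have h2 : d / ‖f‖ * (‖f‖ * d) ≤ d / ‖f‖ * (f p - f q) := by gcongr
    have h3 : d / ‖f‖ * (‖f‖ * d) = d ^ 2 := by field_simp
    simp only [hw, smul_apply, smul_eq_mul]
    linarith
  have hbdd : BddBelow (w '' A) := ⟨w q₀ + d ^ 2, by
    rintro _ ⟨p, hp, rfl⟩; exact hgap p hp q₀ hq₀⟩
  refine ⟨w, sInf (w '' A), sInf (w '' A) - d ^ 2, fun p hp => csInf_le hbdd ⟨p, hp, rfl⟩,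
    fun q hq => ?_, ?_, by ring⟩
  · rw [le_sub_iff_add_le]
    refine le_csInf ⟨_, p₀, hp₀, rfl⟩ ?_
    rintro _ ⟨p, hp, rfl⟩
    exact hgap p hp q hq
  · rw [hw, norm_smul, Real.norm_of_nonneg (by positivity)]
    field_simp

end Sets

/-! ### Splitting sums by class and rescaling multipliers. -/

section Labels

variable {X : Type*} {m : ℕ} {K : Fin m → Set X} {y : Fin m → ℝ}

theorem mem_classIdx {c : ℝ} {i : Fin m} : i ∈ classIdx y c ↔ y i = c := by
  simp [classIdx]

theorem sum_eq_sum_classIdx_add {M : Type*} [AddCommMonoid M] (hy : ∀ i, y i = 1 ∨ y i = -1)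
    (f : Fin m → M) :
    ∑ i, f i = ∑ i ∈ classIdx y 1, f i + ∑ i ∈ classIdx y (-1), f i := by
  rw [← Finset.sum_filter_add_sum_filter_not Finset.univ (fun i => y i = 1)]
  congr 1
  refine Finset.sum_congr (Finset.filter_congr fun i _ => ?_) fun _ _ => rfl
  rcases hy i with h | h <;> rw [h] <;> norm_num

theorem sum_mul_label (hy : ∀ i, y i = 1 ∨ y i = -1) (l : Fin m → ℝ) :
    ∑ i, l i * y i = ∑ i ∈ classIdx y 1, l i - ∑ i ∈ classIdx y (-1), l i := by
  rw [sum_eq_sum_classIdx_add hy, sub_eq_add_neg, ← Finset.sum_neg_distrib]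
  congr 1 <;> exact Finset.sum_congr rfl fun i hi => by rw [mem_classIdx.1 hi]; ring

theorem smul_mem_feasODSVM (hy : ∀ i, y i = 1 ∨ y i = -1) {l : Fin m → ℝ} {x : Fin m → X}
    (h : (l, x) ∈ feasODCM K y) {t : ℝ} (ht : 0 ≤ t) :
    (t • l, x) ∈ feasODSVM K y ∧ ∑ i, (t • l) i = 2 * t := by
  obtain ⟨hl, hx, h1, h2⟩ := h
  simp only at h1 h2
  refine ⟨⟨fun i => mul_nonneg ht (hl i), hx, ?_⟩, ?_⟩
  · rw [sum_mul_label hy]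
    simp only [Pi.smul_apply, smul_eq_mul, ← Finset.mul_sum, h1, h2, sub_self]
  · rw [sum_eq_sum_classIdx_add hy]
    simp only [Pi.smul_apply, smul_eq_mul, ← Finset.mul_sum, h1, h2]
    ring

/-- The constraint `∑ l i y i = 0` gives each class half of the total mass, so the factor `2/S`
normalizes both classes at once. -/
theorem smul_mem_feasODCM (hy : ∀ i, y i = 1 ∨ y i = -1) {l : Fin m → ℝ} {x : Fin m → X}
    (h : (l, x) ∈ feasODSVM K y) (hs : ∑ i, l i ≠ 0) :
    ((2 / ∑ i, l i) • l, x) ∈ feasODCM K y := by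
  obtain ⟨hl, hx, h0⟩ := h
  simp only at h0 hl
  have hS : 0 ≤ ∑ i, l i := Finset.sum_nonneg fun i _ => hl i
  rw [sum_mul_label hy] at h0
  have h1 := sum_eq_sum_classIdx_add hy l
  refine ⟨fun i => mul_nonneg (by positivity) (hl i), hx, ?_, ?_⟩ <;>
  · simp only [Pi.smul_apply, smul_eq_mul, ← Finset.mul_sum]
    rw [div_mul_eq_mul_div, div_eq_one_iff_eq hs]
    linarith

end Labels

/-! ### Convex hulls of the classes and their parametrization. -/

section Problems

variable {X : Type*} [NormedAddCommGroup X] [NormedSpace ℝ X] {m : ℕ}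
  {K : Fin m → Set X} {y : Fin m → ℝ}

theorem subset_classHull {c : ℝ} {i : Fin m} (hi : i ∈ classIdx y c) : K i ⊆ classHull K y c :=
  (Set.subset_biUnion_of_mem (u := K) hi).trans (subset_convexHull ℝ _)

theorem classHull_nonempty {c : ℝ} (hc : ∃ i, y i = c) (hne : ∀ i, (K i).Nonempty) :
    (classHull K y c).Nonempty := by
  obtain ⟨i, hi⟩ := hc
  exact (hne i).mono (subset_classHull (mem_classIdx.2 hi))

theorem convex_classHull (c : ℝ) : Convex ℝ (classHull K y c) := convex_convexHull ℝ _

theorem classPoint_mem_classHull {c : ℝ} {l : Fin m → ℝ} {x : Fin m → X} (hl : ∀ i, 0 ≤ l i)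
    (hx : ∀ i, x i ∈ K i) (hs : ∑ i ∈ classIdx y c, l i = 1) :
    classPoint y c l x ∈ classHull K y c :=
  (convex_classHull c).sum_mem (fun i _ => hl i) hs fun i hi => subset_classHull hi (hx i)

/-- Combinations using one point per `K i` already form a convex set, because each `K i` is convex;
this set contains every `K i` of the class, hence the hull. -/
theorem exists_classPoint_eq (hne : ∀ i, (K i).Nonempty) (hconv : ∀ i, Convex ℝ (K i)) {c : ℝ}
    {p : X} (hp : p ∈ classHull K y c) :
    ∃ (l : Fin m → ℝ) (x : Fin m → X), (∀ i, 0 ≤ l i) ∧ (∀ i, x i ∈ K i) ∧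
      ∑ i ∈ classIdx y c, l i = 1 ∧ classPoint y c l x = p := by
  choose x₀ hx₀ using hne
  refine convexHull_min (t := {p | ∃ (l : Fin m → ℝ) (x : Fin m → X), (∀ i, 0 ≤ l i) ∧
    (∀ i, x i ∈ K i) ∧ ∑ i ∈ classIdx y c, l i = 1 ∧ classPoint y c l x = p}) ?_ ?_ hp
  · intro z hz
    simp only [Set.mem_iUnion] at hz
    obtain ⟨i, hi, hz⟩ := hz
    refine ⟨Pi.single i 1, Function.update x₀ i z, fun j => ?_, fun j => ?_, ?_, ?_⟩
    · by_cases h : j = i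
      · subst h; simp
      · simp [h]
    · by_cases h : j = i
      · subst h; simpa using hz
      · simpa [h] using hx₀ j
    · rw [Finset.sum_eq_single_of_mem i hi fun j _ h => by simp [h]]
      simp
    · rw [classPoint, Finset.sum_eq_single_of_mem i hi fun j _ h => by simp [h]]
      simp
  · rintro _ ⟨l, x, hl, hx, hs, rfl⟩ _ ⟨l', x', hl', hx', hs', rfl⟩ a b ha hb hab
    -- The two contributions of index `i` merge into one point of `K i` carrying the total weight;
    -- if that weight is zero, any point serves.
    have key : ∀ i, ∃ z ∈ K i, (a * l i + b * l' i) • z = a • l i • x i + b • l' i • x' i := by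
      intro i
      have h1 : 0 ≤ a * l i := mul_nonneg ha (hl i)
      have h2 : 0 ≤ b * l' i := mul_nonneg hb (hl' i)
      rcases (add_nonneg h1 h2).eq_or_lt with h | h
      · have e1 : a * l i = 0 := by linarith
        have e2 : b * l' i = 0 := by linarith
        exact ⟨x i, hx i, by simp [smul_smul, e1, e2]⟩
      · refine ⟨_, hconv i (hx i) (hx' i) (div_nonneg h1 h.le) (div_nonneg h2 h.le)
          (by rw [← add_div, div_self h.ne']), ?_⟩
        rw [smul_add, smul_smul, smul_smul, mul_div_cancel₀ _ h.ne', mul_div_cancel₀ _ h.ne',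
          smul_smul, smul_smul]
    choose z hz hz' using key
    refine ⟨fun i => a * l i + b * l' i, z,
      fun i => add_nonneg (mul_nonneg ha (hl i)) (mul_nonneg hb (hl' i)), hz, ?_, ?_⟩
    · rw [Finset.sum_add_distrib, ← Finset.mul_sum, ← Finset.mul_sum, hs, hs', mul_one, mul_one,
        hab]
    · simp only [classPoint, hz', Finset.sum_add_distrib, Finset.smul_sum]

theorem mem_classHull_iff_exists_feasODCM (hne : ∀ i, (K i).Nonempty)
    (hconv : ∀ i, Convex ℝ (K i)) (p q : X) :
    (p ∈ classHull K y 1 ∧ q ∈ classHull K y (-1)) ↔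
      ∃ l x, (l, x) ∈ feasODCM K y ∧ classPoint y 1 l x = p ∧ classPoint y (-1) l x = q := by
  constructor
  · rintro ⟨hp, hq⟩
    obtain ⟨l, x, hl, hx, hs, rfl⟩ := exists_classPoint_eq hne hconv hp
    obtain ⟨l', x', hl', hx', hs', rfl⟩ := exists_classPoint_eq hne hconv hq
    have hP : ∀ i ∈ classIdx y 1, y i = 1 := fun i hi => mem_classIdx.1 hi
    have hN : ∀ i ∈ classIdx y (-1), y i ≠ 1 := fun i hi => by
      rw [mem_classIdx.1 hi]; norm_num
    -- The classes share no index, so the data for `p` and `q` can be glued along the label.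
    refine ⟨fun i => if y i = 1 then l i else l' i, fun i => if y i = 1 then x i else x' i,
      ⟨fun i => ?_, fun i => ?_, ?_, ?_⟩, ?_, ?_⟩
    · dsimp only; split_ifs; exacts [hl i, hl' i]
    · dsimp only; split_ifs; exacts [hx i, hx' i]
    · exact (Finset.sum_congr rfl fun i hi => if_pos (hP i hi)).trans hs
    · exact (Finset.sum_congr rfl fun i hi => if_neg (hN i hi)).trans hs'
    · exact Finset.sum_congr rfl fun i hi => by simp only [if_pos (hP i hi)]
    · exact Finset.sum_congr rfl fun i hi => by simp only [if_neg (hN i hi)]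
  · rintro ⟨l, x, ⟨hl, hx, h1, h2⟩, rfl, rfl⟩
    exact ⟨classPoint_mem_classHull hl hx h1, classPoint_mem_classHull hl hx h2⟩

theorem sum_smul_label (hy : ∀ i, y i = 1 ∨ y i = -1) (l : Fin m → ℝ) (x : Fin m → X) :
    ∑ i, (l i * y i) • x i = classPoint y 1 l x - classPoint y (-1) l x := by
  rw [sum_eq_sum_classIdx_add hy, sub_eq_add_neg, classPoint, classPoint,
    ← Finset.sum_neg_distrib]
  congr 1 <;> exact Finset.sum_congr rfl fun i hi => by rw [mem_classIdx.1 hi]; simp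

theorem sum_smul_mul_smul (t : ℝ) (l : Fin m → ℝ) (x : Fin m → X) :
    ∑ i, ((t • l) i * y i) • x i = t • ∑ i, (l i * y i) • x i := by
  rw [Finset.smul_sum]
  exact Finset.sum_congr rfl fun i _ => by rw [smul_smul, Pi.smul_apply, smul_eq_mul, mul_assoc]

/-! ### The primal problems. -/

theorem forall_classIdx_le_iff {c a : ℝ} {w : StrongDual ℝ X} :
    (∀ i ∈ classIdx y c, ∀ x ∈ K i, a ≤ w x) ↔ ∀ p ∈ classHull K y c, a ≤ w p := by
  refine ⟨fun h => ?_, fun h i hi x hx => h x (subset_classHull hi hx)⟩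
  refine convexHull_min (t := {p | a ≤ w p}) ?_ (convex_halfSpace_ge w.isLinear a)
  exact Set.iUnion₂_subset h

theorem forall_classIdx_ge_iff {c a : ℝ} {w : StrongDual ℝ X} :
    (∀ i ∈ classIdx y c, ∀ x ∈ K i, w x ≤ a) ↔ ∀ p ∈ classHull K y c, w p ≤ a := by
  refine ⟨fun h => ?_, fun h i hi x hx => h x (subset_classHull hi hx)⟩
  refine convexHull_min (t := {p | w p ≤ a}) ?_ (convex_halfSpace_le w.isLinear a)
  exact Set.iUnion₂_subset h

theorem mem_feasRCM_iff {w : StrongDual ℝ X} {a b : ℝ} :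
    (w, a, b) ∈ feasRCM K y ↔
      (∀ p ∈ classHull K y 1, a ≤ w p) ∧ ∀ q ∈ classHull K y (-1), w q ≤ b :=
  and_congr forall_classIdx_le_iff forall_classIdx_ge_iff

/-- (R-SVM) is the slice `α - β = 2` of the (R-CM) constraints, with `α = 1 - b` and `β = -1 - b`.
-/
theorem mem_feasRSVM_iff (hy : ∀ i, y i = 1 ∨ y i = -1) {w : StrongDual ℝ X} {b : ℝ} :
    (w, b) ∈ feasRSVM K y ↔ (w, 1 - b, -1 - b) ∈ feasRCM K y := by
  constructor
  · intro h
    refine ⟨fun i hi x hx => ?_, fun i hi x hx => ?_⟩ <;>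
    · have := h i x hx
      rw [mem_classIdx.1 hi] at this
      dsimp only at this ⊢
      linarith
  · rintro ⟨h1, h2⟩ i x hx
    rcases hy i with h | h
    · have := h1 i (mem_classIdx.2 h) x hx
      dsimp only at this ⊢
      rw [h]; linarith
    · have := h2 i (mem_classIdx.2 h) x hx
      dsimp only at this ⊢
      rw [h]; linarith

theorem smul_mem_feasRCM {w : StrongDual ℝ X} {a b t : ℝ} (ht : 0 ≤ t)
    (h : (w, a, b) ∈ feasRCM K y) : (t • w, t * a, t * b) ∈ feasRCM K y :=
  ⟨fun i hi x hx => mul_le_mul_of_nonneg_left (h.1 i hi x hx) ht,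
    fun i hi x hx => mul_le_mul_of_nonneg_left (h.2 i hi x hx) ht⟩

theorem sub_le_of_mem_feasRCM (hP : (classHull K y 1).Nonempty)
    (hN : (classHull K y (-1)).Nonempty) {w : StrongDual ℝ X} {a b : ℝ}
    (h : (w, a, b) ∈ feasRCM K y) :
    a - b ≤ ‖w‖ * setDist (classHull K y 1) (classHull K y (-1)) :=
  sub_le_norm_mul_setDist hP hN (mem_feasRCM_iff.1 h).1 (mem_feasRCM_iff.1 h).2

theorem exists_mem_feasRCM (hP : (classHull K y 1).Nonempty)
    (hN : (classHull K y (-1)).Nonempty)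
    (hd : 0 < setDist (classHull K y 1) (classHull K y (-1))) :
    ∃ (w : StrongDual ℝ X) (a b : ℝ), (w, a, b) ∈ feasRCM K y ∧
      ‖w‖ = setDist (classHull K y 1) (classHull K y (-1)) ∧
      a - b = setDist (classHull K y 1) (classHull K y (-1)) ^ 2 := by
  obtain ⟨w, a, b, ha, hb, h⟩ :=
    exists_separating_norm_eq_setDist hP hN (convex_classHull 1) (convex_classHull (-1)) hd
  exact ⟨w, a, b, mem_feasRCM_iff.2 ⟨ha, hb⟩, h⟩

/-- By `α - β ≤ ‖w‖ d`, the objective is at least `‖w‖²/2 - ‖w‖ d = (‖w‖ - d)²/2 - d²/2`. The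
separating functional attains `-d²/2`, so a solution must have equality in both estimates. -/
theorem solvesRCM_iff (hP : (classHull K y 1).Nonempty) (hN : (classHull K y (-1)).Nonempty)
    (hd : 0 < setDist (classHull K y 1) (classHull K y (-1))) {w : StrongDual ℝ X} {a b : ℝ} :
    SolvesRCM K y w a b ↔ (w, a, b) ∈ feasRCM K y ∧
      ‖w‖ = setDist (classHull K y 1) (classHull K y (-1)) ∧
      a - b = setDist (classHull K y 1) (classHull K y (-1)) ^ 2 := by
  obtain ⟨w₀, a₀, b₀, h₀, hw₀, hab₀⟩ := exists_mem_feasRCM hP hN hd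
  refine and_congr_right fun hf => ⟨fun h => ?_, ?_⟩
  · have h1 := h _ h₀
    have h2 := sub_le_of_mem_feasRCM hP hN hf
    simp only [objRCM, hw₀, hab₀] at h1
    have h3 : ‖w‖ = setDist (classHull K y 1) (classHull K y (-1)) := by
      nlinarith [sq_nonneg (‖w‖ - setDist (classHull K y 1) (classHull K y (-1)))]
    refine ⟨h3, ?_⟩
    rw [h3] at h1 h2
    nlinarith
  · rintro ⟨h1, h2⟩ ⟨w', a', b'⟩ h'
    have h3 := sub_le_of_mem_feasRCM hP hN h'
    simp only [objRCM, h1, h2]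
    nlinarith [sq_nonneg (‖w'‖ - setDist (classHull K y 1) (classHull K y (-1)))]

theorem two_le_of_mem_feasRSVM (hy : ∀ i, y i = 1 ∨ y i = -1)
    (hP : (classHull K y 1).Nonempty) (hN : (classHull K y (-1)).Nonempty)
    {w : StrongDual ℝ X} {b : ℝ} (h : (w, b) ∈ feasRSVM K y) :
    2 ≤ ‖w‖ * setDist (classHull K y 1) (classHull K y (-1)) := by
  have := sub_le_of_mem_feasRCM hP hN ((mem_feasRSVM_iff hy).1 h)
  linarith

theorem smul_mem_feasRSVM (hy : ∀ i, y i = 1 ∨ y i = -1) {w : StrongDual ℝ X} {a b : ℝ}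
    (h : (w, a, b) ∈ feasRCM K y) (hab : 0 < a - b) :
    ((2 / (a - b)) • w, -((a + b) / (a - b))) ∈ feasRSVM K y := by
  rw [mem_feasRSVM_iff hy]
  convert smul_mem_feasRCM (t := 2 / (a - b)) (by positivity) h using 3 <;> field_simp <;> ring

/-- On the slice `α - β = 2` the primal bound reads `2/d ≤ ‖w‖`; the separating functional scaled by
`2/d²` attains it. -/
theorem solvesRSVM_iff (hy : ∀ i, y i = 1 ∨ y i = -1)
    (hP : (classHull K y 1).Nonempty) (hN : (classHull K y (-1)).Nonempty)
    (hd : 0 < setDist (classHull K y 1) (classHull K y (-1))) {w : StrongDual ℝ X} {b : ℝ} :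
    SolvesRSVM K y w b ↔ (w, b) ∈ feasRSVM K y ∧
      ‖w‖ = 2 / setDist (classHull K y 1) (classHull K y (-1)) := by
  have hlow : ∀ {w : StrongDual ℝ X} {b : ℝ}, (w, b) ∈ feasRSVM K y →
      2 / setDist (classHull K y 1) (classHull K y (-1)) ≤ ‖w‖ := fun h =>
    (div_le_iff₀ hd).2 (two_le_of_mem_feasRSVM hy hP hN h)
  obtain ⟨w₀, a₀, b₀, h₀, hw₀, hab₀⟩ := exists_mem_feasRCM hP hN hd
  refine and_congr_right fun hf => ⟨fun h => ?_, ?_⟩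
  · have h1 := h _ (smul_mem_feasRSVM hy h₀ (by rw [hab₀]; positivity))
    simp only [objRSVM, norm_smul, hw₀, hab₀] at h1
    refine le_antisymm (le_of_sq_le_sq ?_ (by positivity)) (hlow hf)
    rw [Real.norm_of_nonneg (by positivity)] at h1
    have e : 2 / setDist (classHull K y 1) (classHull K y (-1)) ^ 2 *
      setDist (classHull K y 1) (classHull K y (-1)) =
        2 / setDist (classHull K y 1) (classHull K y (-1)) := by field_simp
    rw [e] at h1
    linarith
  · rintro h1 ⟨w', b'⟩ h'
    have h2 := hlow h'
    simp only [objRSVM, h1]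
    gcongr

/-! ### The dual problems. -/

theorem objODCM_eq (hy : ∀ i, y i = 1 ∨ y i = -1) (l : Fin m → ℝ) (x : Fin m → X) :
    objODCM y (l, x) = -((1 / 2) * ‖classPoint y 1 l x - classPoint y (-1) l x‖ ^ 2) := by
  rw [objODCM, sum_smul_label hy]

theorem setDist_le_of_mem_feasODCM (hy : ∀ i, y i = 1 ∨ y i = -1) {l : Fin m → ℝ}
    {x : Fin m → X} (h : (l, x) ∈ feasODCM K y) :
    setDist (classHull K y 1) (classHull K y (-1)) ≤ ‖∑ i, (l i * y i) • x i‖ := by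
  rw [sum_smul_label hy]
  exact setDist_le (classPoint_mem_classHull h.1 h.2.1 h.2.2.1)
    (classPoint_mem_classHull h.1 h.2.1 h.2.2.2)

/-- Identifies `d²` as the greatest lower bound over feasible points, so that optimality can be
tested without a nearest pair at hand. -/
theorem le_setDist_sq_of_feasODCM (hy : ∀ i, y i = 1 ∨ y i = -1)
    (hne : ∀ i, (K i).Nonempty) (hconv : ∀ i, Convex ℝ (K i))
    (hP : (classHull K y 1).Nonempty) (hN : (classHull K y (-1)).Nonempty) {c : ℝ}
    (h : ∀ l x, (l, x) ∈ feasODCM K y → c ≤ ‖∑ i, (l i * y i) • x i‖ ^ 2) :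
    c ≤ setDist (classHull K y 1) (classHull K y (-1)) ^ 2 := by
  refine le_setDist_sq hP hN fun p hp q hq => ?_
  obtain ⟨l, x, hf, rfl, rfl⟩ := (mem_classHull_iff_exists_feasODCM hne hconv p q).1 ⟨hp, hq⟩
  rw [← sum_smul_label hy]
  exact h l x hf

theorem solvesODCM_iff (hy : ∀ i, y i = 1 ∨ y i = -1)
    (hne : ∀ i, (K i).Nonempty) (hconv : ∀ i, Convex ℝ (K i))
    (hP : (classHull K y 1).Nonempty) (hN : (classHull K y (-1)).Nonempty)
    {l : Fin m → ℝ} {x : Fin m → X} :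
    SolvesODCM K y l x ↔ (l, x) ∈ feasODCM K y ∧
      ‖∑ i, (l i * y i) • x i‖ = setDist (classHull K y 1) (classHull K y (-1)) := by
  refine and_congr_right fun hf => ⟨fun h => ?_, ?_⟩
  · refine le_antisymm (le_of_sq_le_sq ?_ (setDist_nonneg _ _)) (setDist_le_of_mem_feasODCM hy hf)
    refine le_setDist_sq_of_feasODCM hy hne hconv hP hN fun l' x' h' => ?_
    have := h _ h'
    simp only [objODCM] at this
    linarith
  · rintro h1 ⟨l', x'⟩ h'
    have h2 := setDist_le_of_mem_feasODCM hy h'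
    have h3 := setDist_nonneg (classHull K y 1) (classHull K y (-1))
    simp only [objODCM, h1]
    gcongr

theorem isLUB_objODCM (hy : ∀ i, y i = 1 ∨ y i = -1)
    (hne : ∀ i, (K i).Nonempty) (hconv : ∀ i, Convex ℝ (K i))
    (hP : (classHull K y 1).Nonempty) (hN : (classHull K y (-1)).Nonempty) :
    IsLUB (objODCM y '' feasODCM K y)
      (-((1 / 2) * setDist (classHull K y 1) (classHull K y (-1)) ^ 2)) := by
  constructor
  · rintro _ ⟨⟨l, x⟩, h, rfl⟩
    have h2 := setDist_le_of_mem_feasODCM hy h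
    have h3 := setDist_nonneg (classHull K y 1) (classHull K y (-1))
    simp only [objODCM]
    gcongr
  · intro v hv
    have : -2 * v ≤ setDist (classHull K y 1) (classHull K y (-1)) ^ 2 :=
      le_setDist_sq_of_feasODCM hy hne hconv hP hN fun l x h => by
        have := hv ⟨_, h, rfl⟩
        simp only [objODCM] at this
        linarith
    linarith

theorem setDist_mul_le_of_mem_feasODSVM (hy : ∀ i, y i = 1 ∨ y i = -1) {l : Fin m → ℝ}
    {x : Fin m → X} (h : (l, x) ∈ feasODSVM K y) :
    (∑ i, l i) * setDist (classHull K y 1) (classHull K y (-1)) ≤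
      2 * ‖∑ i, (l i * y i) • x i‖ := by
  rcases (Finset.sum_nonneg fun i _ => h.1 i : 0 ≤ ∑ i, l i).eq_or_lt with hs | hs
  · rw [← hs]; simp
  · have := setDist_le_of_mem_feasODCM hy (smul_mem_feasODCM hy h hs.ne')
    rw [sum_smul_mul_smul, norm_smul, Real.norm_of_nonneg (by positivity), div_mul_eq_mul_div,
      le_div_iff₀ hs] at this
    linarith

/-- With `S = ∑ l i`, rescaling to (OD-CM) gives `‖∑ l i y i x i‖ ≥ S d/2`, so the objective is at
most `S - S² d²/8`, which peaks at `S = 4/d²` with value `2/d²`. A solution reaches this value,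
which forces equality in both estimates. -/
theorem solvesODSVM_iff (hy : ∀ i, y i = 1 ∨ y i = -1)
    (hne : ∀ i, (K i).Nonempty) (hconv : ∀ i, Convex ℝ (K i))
    (hP : (classHull K y 1).Nonempty) (hN : (classHull K y (-1)).Nonempty)
    (hd : 0 < setDist (classHull K y 1) (classHull K y (-1)))
    {l : Fin m → ℝ} {x : Fin m → X} :
    SolvesODSVM K y l x ↔ (l, x) ∈ feasODSVM K y ∧
      ∑ i, l i = 4 / setDist (classHull K y 1) (classHull K y (-1)) ^ 2 ∧
      ‖∑ i, (l i * y i) • x i‖ = 2 / setDist (classHull K y 1) (classHull K y (-1)) := by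
  set d := setDist (classHull K y 1) (classHull K y (-1)) with hd_def
  -- the bound `S - ‖v‖² / 2 ≤ 2 / d²`, with its defect written as a sum of squares
  have hsq : ∀ s : ℝ, s - s ^ 2 * d ^ 2 / 8 = 2 / d ^ 2 - (s - 4 / d ^ 2) ^ 2 * (d ^ 2 / 8) := by
    intro s; field_simp; ring
  have hle : ∀ {l : Fin m → ℝ} {x : Fin m → X}, (l, x) ∈ feasODSVM K y →
      (∑ i, l i) ^ 2 * d ^ 2 / 4 ≤ ‖∑ i, (l i * y i) • x i‖ ^ 2 := by
    intro l x h
    have h1 := setDist_mul_le_of_mem_feasODSVM hy h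
    have h2 : 0 ≤ ∑ i, l i := Finset.sum_nonneg fun i _ => h.1 i
    have h3 := pow_le_pow_left₀ (mul_nonneg h2 hd.le) h1 2
    nlinarith
  refine and_congr_right fun hf => ⟨fun h => ?_, ?_⟩
  · have hv : 2 / d ^ 2 ≤ objODSVM y (l, x) := by
      -- An (OD-CM) point of norm `n`, scaled by `2/d²` to have the optimal mass `4/d²`, has
      -- objective `4/d² - 2n²/d⁴`. Comparing with the maximizer and solving for `n²` gives a bound
      -- that passes to the infimum `d²`.
      have key : d ^ 4 / 2 * (4 / d ^ 2 - objODSVM y (l, x)) ≤ d ^ 2 := by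
        refine le_setDist_sq_of_feasODCM hy hne hconv hP hN fun l' x' h' => ?_
        obtain ⟨h1, h2⟩ := smul_mem_feasODSVM hy h' (t := 2 / d ^ 2) (by positivity)
        have h3 := h _ h1
        have h4 : objODSVM y ((2 / d ^ 2) • l', x') =
            4 / d ^ 2 - 2 / d ^ 4 * ‖∑ i, (l' i * y i) • x' i‖ ^ 2 := by
          simp only [objODSVM]
          rw [h2, sum_smul_mul_smul, norm_smul, Real.norm_of_nonneg (by positivity)]
          field_simp
          ring
        rw [h4] at h3
        calc d ^ 4 / 2 * (4 / d ^ 2 - objODSVM y (l, x))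
            ≤ d ^ 4 / 2 * (2 / d ^ 4 * ‖∑ i, (l' i * y i) • x' i‖ ^ 2) := by
              gcongr; linarith
          _ = _ := by field_simp
      have e : d ^ 4 / 2 * (2 / d ^ 2) = d ^ 2 := by field_simp
      have : d ^ 4 / 2 * (4 / d ^ 2 - objODSVM y (l, x)) ≤ d ^ 4 / 2 * (2 / d ^ 2) := by rwa [e]
      have := le_of_mul_le_mul_left this (by positivity)
      have e2 : 4 / d ^ 2 = 2 / d ^ 2 + 2 / d ^ 2 := by ring
      linarith
    simp only [objODSVM] at hv
    have h1 := hle hf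
    have h2 := hsq (∑ i, l i)
    have h3 : (∑ i, l i - 4 / d ^ 2) ^ 2 * (d ^ 2 / 8) = 0 :=
      le_antisymm (by linarith) (by positivity)
    have h4 : ∑ i, l i = 4 / d ^ 2 := by
      have : (∑ i, l i - 4 / d ^ 2) ^ 2 = 0 := (mul_eq_zero.1 h3).resolve_right (by positivity)
      exact sub_eq_zero.1 (pow_eq_zero_iff two_ne_zero |>.1 this)
    refine ⟨h4, (sq_eq_sq₀ (norm_nonneg _) (by positivity)).1 ?_⟩
    rw [h4] at hv h1
    have e1 : (4 / d ^ 2) ^ 2 * d ^ 2 / 4 = (2 / d) ^ 2 := by field_simp; norm_num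
    have e2 : 4 / d ^ 2 - 2 / d ^ 2 = 1 / 2 * (2 / d) ^ 2 := by field_simp; norm_num
    linarith
  · rintro ⟨h1, h2⟩ ⟨l', x'⟩ h'
    have h3 := hle h'
    have h4 := hsq (∑ i, l' i)
    have h5 : 0 ≤ (∑ i, l' i - 4 / d ^ 2) ^ 2 * (d ^ 2 / 8) := by positivity
    have e2 : 4 / d ^ 2 - 2 / d ^ 2 = 1 / 2 * (2 / d) ^ 2 := by field_simp; norm_num
    simp only [objODSVM, h1, h2]
    linarith

end Problems

end RobustSVM

/-! ### The correspondence between the two pairs. -/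

theorem mainTheorem3
    {X : Type*} [NormedAddCommGroup X] [NormedSpace ℝ X] [CompleteSpace X]
    {m : ℕ} (K : Fin m → Set X) (y : Fin m → ℝ)
    (hy : ∀ i, y i = 1 ∨ y i = -1)
    (hpos : ∃ i, y i = 1) (hneg : ∃ i, y i = -1)
    (hne : ∀ i, (K i).Nonempty)
    (hconv : ∀ i, Convex ℝ (K i))
    (hcomp : ∀ i, WeaklyCompact (K i))
    (hdisj : classHull K y 1 ∩ classHull K y (-1) = ∅) :
    -- solutions of the first pair are mapped to solutions of the second pair
    (∀ (w : StrongDual ℝ X) (b : ℝ) (l : Fin m → ℝ) (x : Fin m → X),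
      SolvesRSVM K y w b → SolvesODSVM K y l x →
        ∑ i, l i ≠ 0 ∧
        SolvesRCM K y ((2 / ∑ i, l i) • w)
          (2 * (1 - b) / ∑ i, l i) (2 * (-1 - b) / ∑ i, l i) ∧
        SolvesODCM K y ((2 / ∑ i, l i) • l) x) ∧
    -- solutions of the second pair are mapped to solutions of the first pair
    (∀ (w : StrongDual ℝ X) (α β : ℝ) (l : Fin m → ℝ) (x : Fin m → X),
      SolvesRCM K y w α β → SolvesODCM K y l x →
        α - β ≠ 0 ∧
        SolvesRSVM K y ((2 / (α - β)) • w) (-((α + β) / (α - β))) ∧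
        SolvesODSVM K y ((2 / (α - β)) • l) x) ∧
    -- (OD-CM) is the nearest point problem between the two convex hulls: the feasible points
    -- parametrize the pairs of points, the objective is minus half the squared distance, and
    -- the solutions and the optimal value correspond
    ((∀ p q : X, (p ∈ classHull K y 1 ∧ q ∈ classHull K y (-1)) ↔
        ∃ l x, (l, x) ∈ feasODCM K y ∧ classPoint y 1 l x = p ∧ classPoint y (-1) l x = q) ∧
     (∀ (l : Fin m → ℝ) (x : Fin m → X),
        objODCM y (l, x) = -((1 / 2) * ‖classPoint y 1 l x - classPoint y (-1) l x‖ ^ 2)) ∧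
     (∀ (l : Fin m → ℝ) (x : Fin m → X), SolvesODCM K y l x ↔
        (l, x) ∈ feasODCM K y ∧
        NearestPair (classHull K y 1) (classHull K y (-1))
          (classPoint y 1 l x) (classPoint y (-1) l x)) ∧
     IsLUB (objODCM y '' feasODCM K y)
        (-((1 / 2) * setDist (classHull K y 1) (classHull K y (-1)) ^ 2))) := by
  have hP : (classHull K y 1).Nonempty := classHull_nonempty hpos hne
  have hN : (classHull K y (-1)).Nonempty := classHull_nonempty hneg hne
  refine ⟨fun w b l x hw hl => ?_, fun w α β l x hw hl => ?_,
    mem_classHull_iff_exists_feasODCM hne hconv, objODCM_eq hy, fun l x => ?_,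
    isLUB_objODCM hy hne hconv hP hN⟩
  -- Feasibility for (R-SVM) alone forces `2 ≤ ‖w‖ d`, hence `d > 0`.
  · have hd : 0 < setDist (classHull K y 1) (classHull K y (-1)) :=
      pos_of_mul_pos_right (two_pos.trans_le (two_le_of_mem_feasRSVM hy hP hN hw.1))
        (norm_nonneg w)
    obtain ⟨hw, hwn⟩ := (solvesRSVM_iff hy hP hN hd).1 hw
    obtain ⟨hl, hs, hln⟩ := (solvesODSVM_iff hy hne hconv hP hN hd).1 hl
    have hs0 : 0 < ∑ i, l i := by rw [hs]; positivity
    have hn : ‖2 / ∑ i, l i‖ = setDist (classHull K y 1) (classHull K y (-1)) ^ 2 / 2 := by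
      rw [Real.norm_of_nonneg (by positivity), hs]
      field_simp
      norm_num
    refine ⟨hs0.ne', (solvesRCM_iff hP hN hd).2 ⟨?_, ?_, ?_⟩,
      (solvesODCM_iff hy hne hconv hP hN).2 ⟨smul_mem_feasODCM hy hl hs0.ne', ?_⟩⟩
    · rw [← div_mul_eq_mul_div, ← div_mul_eq_mul_div]
      exact smul_mem_feasRCM (by positivity) ((mem_feasRSVM_iff hy).1 hw)
    · rw [norm_smul, hn, hwn]
      field_simp
    · rw [hs]
      field_simp
      ring
    · rw [sum_smul_mul_smul, norm_smul, hn, hln]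
      field_simp
  · obtain ⟨hl, hln⟩ := (solvesODCM_iff hy hne hconv hP hN).1 hl
    -- Here the distance is attained by the dual solution, so `d = 0` would give a common point of
    -- the disjoint hulls.
    have hd : 0 < setDist (classHull K y 1) (classHull K y (-1)) := by
      rw [← hln, norm_pos_iff, sum_smul_label hy, sub_ne_zero]
      intro h
      refine Set.notMem_empty (classPoint y 1 l x) (hdisj ▸ ⟨?_, ?_⟩)
      · exact classPoint_mem_classHull hl.1 hl.2.1 hl.2.2.1
      · rw [h]
        exact classPoint_mem_classHull hl.1 hl.2.1 hl.2.2.2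
    obtain ⟨hw, hwn, hab⟩ := (solvesRCM_iff hP hN hd).1 hw
    have hab0 : 0 < α - β := by rw [hab]; positivity
    have hn : ‖2 / (α - β)‖ = 2 / setDist (classHull K y 1) (classHull K y (-1)) ^ 2 := by
      rw [Real.norm_of_nonneg (by positivity), hab]
    obtain ⟨hl', hs⟩ := smul_mem_feasODSVM hy hl (t := 2 / (α - β)) (by positivity)
    refine ⟨hab0.ne', (solvesRSVM_iff hy hP hN hd).2 ⟨smul_mem_feasRSVM hy hw hab0, ?_⟩,
      (solvesODSVM_iff hy hne hconv hP hN hd).2 ⟨hl', ?_, ?_⟩⟩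
    · rw [norm_smul, hn, hwn]
      field_simp
    · rw [hs, hab]
      ring
    · rw [sum_smul_mul_smul, norm_smul, hn, hln]
      field_simp
  · rw [solvesODCM_iff hy hne hconv hP hN, sum_smul_label hy]
    exact and_congr_right fun h => ⟨fun e => ⟨classPoint_mem_classHull h.1 h.2.1 h.2.2.1,
      classPoint_mem_classHull h.1 h.2.1 h.2.2.2, e⟩, fun e => e.2.2⟩
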